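/- Let $\mathbb{N}=\{1,2,\dots\}$. For $k\in\mathbb{N}$, a set $A\subseteq\mathbb{N}$ is called $k$-multiplicative (Sidon) if for all $x,y\in A$ and all $a,b\in\{1,\dots,k\}$, $ax=by$ implies $a=b$ and $x=y$. A set $A\subseteq\mathbb{N}$ has density $\delta(A)$ if the limit $\delta(A)=\lim_{n\to\infty}|A\cap\{1,\dots,n\}|/n$ exists. Theorem. For every $k\in\mathbb{N}$, the set $$S_k:=\Bigl\{s\in\mathbb{N}:\gcd\Bigl(s,\prod_{p\le k,\ p\text{ prime}}p\Bigr)=1\Bigr\}$$ is $k$-multiplicative, and its density exists and equals $$\delta(S_k)=\prod_{p\le k,\ p\text{ prime}}\Bigl(1-\frac1p\Bigr).$$ Moreover, as $k\to\infty$, $$\delta(S_k)\sim\frac{e^{-\gamma}}{\log k},$$ that is, the ratio of the two sides tends to $1$, where $\gamma$ is the Euler–Mascheroni constant and $\log$ is the natural logarithm. -/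

import Mathlib

open Filter Topology Asymptotics

/-- A set `A` of positive integers is `k`-multiplicative (Sidon) if `a * x = b * y` with `x, y ∈ A`
and `a, b ∈ {1, …, k}` forces `a = b` and `x = y`. -/
def IsMultiplicativeSidon (k : ℕ) (A : Set ℕ) : Prop :=
  (∀ x ∈ A, 1 ≤ x) ∧
    ∀ x ∈ A, ∀ y ∈ A, ∀ a ∈ Finset.Icc 1 k, ∀ b ∈ Finset.Icc 1 k,
      a * x = b * y → a = b ∧ x = y

/-- The set `A` of positive integers has natural density `δ`:
`|A ∩ {1, …, n}| / n` converges to `δ`. -/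
def HasNatDensity (A : Set ℕ) (δ : ℝ) : Prop :=
  Tendsto (fun n : ℕ => ((A ∩ Set.Icc 1 n).ncard : ℝ) / (n : ℝ)) atTop (𝓝 δ)

/-- The set `S_k` of positive integers coprime to the product of all primes in `{1, …, k}`. -/
def coprimeSet (k : ℕ) : Set ℕ := {s : ℕ | 1 ≤ s ∧ Nat.gcd s (∏ p ∈ Nat.primesLE k, p) = 1}

theorem coprime_prod_primesLE_of_mem_Icc {k s b : ℕ}
    (hs : Nat.gcd s (∏ p ∈ Nat.primesLE k, p) = 1) (hb : b ∈ Finset.Icc 1 k) :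
    Nat.Coprime s b := by
  rw [Finset.mem_Icc] at hb
  refine Nat.Coprime.symm (Nat.coprime_of_dvd fun q hq hqb hqs => ?_)
  have hmem : q ∈ Nat.primesLE k :=
    Nat.mem_primesLE.2 ⟨(Nat.le_of_dvd hb.1 hqb).trans hb.2, hq⟩
  have := Nat.dvd_gcd hqs (Finset.dvd_prod_of_mem (fun p => p) hmem)
  rw [hs] at this
  exact hq.one_lt.ne' (Nat.dvd_one.1 this)

theorem isMultiplicativeSidon_coprimeSet (k : ℕ) : IsMultiplicativeSidon k (coprimeSet k) := by
  refine ⟨fun x hx => hx.1, fun x hx y hy a ha b hb h => ?_⟩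
  have hxy : x ∣ y :=
    (coprime_prod_primesLE_of_mem_Icc hx.2 hb).dvd_of_dvd_mul_left (h ▸ Dvd.intro_left a rfl)
  have hyx : y ∣ x :=
    (coprime_prod_primesLE_of_mem_Icc hy.2 ha).dvd_of_dvd_mul_left (h ▸ Dvd.intro_left b rfl)
  have e := Nat.dvd_antisymm hxy hyx
  subst e
  exact ⟨Nat.eq_of_mul_eq_mul_right hx.1 h, rfl⟩

theorem card_filter_coprime_Ico_mul (m q : ℕ) :
    ((Finset.Ico 1 (1 + q * m)).filter fun x => m.Coprime x).card = q * m.totient := by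
  induction q with
  | zero => simp
  | succ q ih =>
    have hd : Finset.Ico 1 (1 + (q + 1) * m) =
        Finset.Ico 1 (1 + q * m) ∪ Finset.Ico (1 + q * m) (1 + q * m + m) := by
      rw [Finset.Ico_union_Ico_eq_Ico (by omega) (by omega)]
      congr 1; ring
    rw [hd, Finset.filter_union, Finset.card_union_of_disjoint, ih,
      Nat.filter_coprime_Ico_eq_totient]
    · ring
    · exact Finset.disjoint_filter_filter (Finset.Ico_disjoint_Ico_consecutive _ _ _)

/-- The integers coprime to `m` have density `φ(m) / m`. -/
theorem tendsto_card_filter_coprime_div {m : ℕ} (hm : 0 < m) :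
    Tendsto (fun n : ℕ => (((Finset.Icc 1 n).filter fun x => m.Coprime x).card : ℝ) / n) atTop
      (𝓝 ((m.totient : ℝ) / m)) := by
  have hm' : (0 : ℝ) < m := by exact_mod_cast hm
  have hq : Tendsto (fun n : ℕ => ((n / m : ℕ) : ℝ) / n) atTop (𝓝 (1 / m)) := by
    have := (tendsto_nat_floor_mul_div_atTop (R := ℝ) (a := 1 / m) (by positivity)).comp
      tendsto_natCast_atTop_atTop
    refine this.congr fun n => ?_
    simp only [Function.comp]
    rw [one_div_mul_eq_div, Nat.floor_div_eq_div]
  have h1 : Tendsto (fun n : ℕ => ((n / m : ℕ) : ℝ) / n * m.totient) atTop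
      (𝓝 ((m.totient : ℝ) / m)) := by
    have := hq.mul_const (m.totient : ℝ)
    rwa [one_div_mul_eq_div] at this
  have h2 : Tendsto (fun n : ℕ => ((n / m : ℕ) : ℝ) / n * m.totient + m.totient / (n : ℝ)) atTop
      (𝓝 ((m.totient : ℝ) / m)) := by
    have := h1.add (tendsto_const_div_atTop_nhds_zero_nat (m.totient : ℝ))
    rwa [add_zero] at this
  refine tendsto_of_tendsto_of_tendsto_of_le_of_le h1 h2 (fun n => ?_) (fun n => ?_)
  · have : n / m * m.totient ≤ ((Finset.Icc 1 n).filter fun x => m.Coprime x).card := by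
      rw [← card_filter_coprime_Ico_mul]
      refine Finset.card_le_card (Finset.filter_subset_filter _ fun x hx => ?_)
      have := Nat.div_mul_le_self n m
      simp only [Finset.mem_Ico, Finset.mem_Icc] at hx ⊢
      omega
    calc ((n / m : ℕ) : ℝ) / n * m.totient = ((n / m * m.totient : ℕ) : ℝ) / n := by
          push_cast; ring
      _ ≤ _ := by gcongr
  · have : ((Finset.Icc 1 n).filter fun x => m.Coprime x).card ≤ (n / m + 1) * m.totient := by
      rw [← card_filter_coprime_Ico_mul]
      refine Finset.card_le_card (Finset.filter_subset_filter _ fun x hx => ?_)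
      have := Nat.lt_div_mul_add (a := n) hm
      simp only [Finset.mem_Ico, Finset.mem_Icc, add_mul] at hx ⊢
      omega
    calc _ ≤ (((n / m + 1) * m.totient : ℕ) : ℝ) / n := by gcongr
      _ = _ := by push_cast; ring

theorem hasNatDensity_coprimeSet (k : ℕ) :
    HasNatDensity (coprimeSet k) (∏ p ∈ Nat.primesLE k, (1 - 1 / (p : ℝ))) := by
  set m := ∏ p ∈ Nat.primesLE k, p with hm
  have hp : ∀ p ∈ Nat.primesLE k, p.Prime := fun p h => (Nat.mem_primesLE.1 h).2
  have hm0 : 0 < m := Finset.prod_pos fun p h => (hp p h).pos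
  have hδ : ∏ p ∈ Nat.primesLE k, (1 - 1 / (p : ℝ)) = (m.totient : ℝ) / m := by
    have h := congrArg (fun x : ℚ => (x : ℝ)) (Nat.totient_eq_mul_prod_factors m)
    rw [hm, Nat.primeFactors_prod hp, ← hm] at h
    push_cast at h
    rw [h, mul_div_cancel_left₀ _ (by exact_mod_cast hm0.ne')]
    simp only [one_div]
  rw [hδ]
  refine (tendsto_card_filter_coprime_div hm0).congr fun n => ?_
  congr 2
  rw [← Set.ncard_coe_finset]
  congr 1
  ext x
  simp only [coprimeSet, Finset.coe_filter, Finset.mem_Icc, Set.mem_ofPred_eq, Set.mem_inter_iff,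
    Set.mem_Icc, ← hm, Nat.coprime_comm (m := m), Nat.Coprime]
  tauto

theorem log_factorial_eq_sum_primesLE (N : ℕ) :
    Real.log (N.factorial) =
      ∑ p ∈ Nat.primesLE N, (N.factorial.factorization p : ℝ) * Real.log p := by
  have h := Nat.prod_factorization_pow_eq_self (Nat.factorial_ne_zero N)
  conv_lhs => rw [← h]
  rw [Finsupp.prod_of_support_subset (s := Nat.primesLE N)]
  · push_cast
    rw [Real.log_prod]
    · simp
    · intro p hp
      have := (Nat.mem_primesLE.1 hp).2.pos
      positivity
  · intro p hp
    have hp' := Nat.prime_of_mem_primeFactors (by simpa using hp)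
    exact Nat.mem_primesLE.2 ⟨(hp'.dvd_factorial).1 (Nat.dvd_of_mem_primeFactors (by simpa using hp)), hp'⟩
  · simp

theorem log_factorial_le_mul_log (N : ℕ) : Real.log (N.factorial) ≤ N * Real.log N := by
  rcases N.eq_zero_or_pos with rfl | hN
  · simp
  rw [← Real.log_pow]
  exact Real.log_le_log (by positivity) (by exact_mod_cast Nat.factorial_le_pow N)

theorem mul_log_sub_le_log_factorial {N : ℕ} (hN : 0 < N) :
    N * Real.log N - N ≤ Real.log (N.factorial) := by
  have h := Real.pow_div_factorial_le_exp (x := N) (by positivity) N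
  have h2 := Real.log_le_log (by positivity) h
  rw [Real.log_exp, Real.log_div (by positivity) (by positivity), Real.log_pow] at h2
  linarith

theorem log_sub_one_le_sum_log_div_sub_one {N : ℕ} (hN : 0 < N) :
    Real.log N - 1 ≤ ∑ p ∈ Nat.primesLE N, Real.log p / ((p : ℝ) - 1) := by
  have hN' : (0 : ℝ) < N := by exact_mod_cast hN
  have h := mul_log_sub_le_log_factorial hN
  rw [log_factorial_eq_sum_primesLE] at h
  have h2 : ∑ p ∈ Nat.primesLE N, (N.factorial.factorization p : ℝ) * Real.log p ≤
      ∑ p ∈ Nat.primesLE N, N * (Real.log p / ((p : ℝ) - 1)) := by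
    refine Finset.sum_le_sum fun p hp => ?_
    have hp' := (Nat.mem_primesLE.1 hp).2
    have h1 : (1 : ℝ) < p := by exact_mod_cast hp'.one_lt
    have h3 : ((p : ℝ) - 1) * N.factorial.factorization p ≤ N := by
      have := (Nat.sub_one_mul_factorization_factorial (n := N) hp').le.trans (Nat.sub_le _ _)
      have h4 : (((p - 1) * N.factorial.factorization p : ℕ) : ℝ) ≤ N := by exact_mod_cast this
      rwa [Nat.cast_mul, Nat.cast_sub hp'.one_le, Nat.cast_one] at h4
    have h5 : (N.factorial.factorization p : ℝ) ≤ N / ((p : ℝ) - 1) := by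
      rw [le_div_iff₀ (by linarith)]; linarith
    calc _ ≤ N / ((p : ℝ) - 1) * Real.log p :=
          mul_le_mul_of_nonneg_right h5 (Real.log_nonneg h1.le)
      _ = _ := by ring
  rw [← Finset.mul_sum] at h2
  refine le_of_mul_le_mul_left ?_ hN'
  linarith

theorem sum_log_div_le_log_add {N : ℕ} (hN : 0 < N) :
    ∑ p ∈ Nat.primesLE N, Real.log p / (p : ℝ) ≤ Real.log N + Real.log 4 := by
  have hN' : (0 : ℝ) < N := by exact_mod_cast hN
  have h := log_factorial_le_mul_log N
  rw [log_factorial_eq_sum_primesLE] at h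
  have hθ := Chebyshev.theta_le_log4_mul_x (x := N) hN'.le
  rw [Chebyshev.theta_eq_sum_primesLE_log] at hθ
  have h2 : ∑ p ∈ Nat.primesLE N, (N * (Real.log p / (p : ℝ)) - Real.log p) ≤
      ∑ p ∈ Nat.primesLE N, (N.factorial.factorization p : ℝ) * Real.log p := by
    refine Finset.sum_le_sum fun p hp => ?_
    have hp' := (Nat.mem_primesLE.1 hp).2
    have h1 : (1 : ℝ) < p := by exact_mod_cast hp'.one_lt
    have h3 : N / p ≤ N.factorial.factorization p := by
      rw [Nat.factorization_factorial hp' (b := Nat.log p N + 2) (by omega)]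
      have := Finset.single_le_sum (f := fun i => N / p ^ i) (s := Finset.Ico 1 (Nat.log p N + 2))
        (fun _ _ => Nat.zero_le _) (a := 1) (by simp)
      simpa using this
    have h4 : (N : ℝ) / p - 1 ≤ N.factorial.factorization p := by
      have h5 : ((N / p : ℕ) : ℝ) ≤ N.factorial.factorization p := by exact_mod_cast h3
      have h6 := Nat.sub_one_lt_floor ((N : ℝ) / p)
      rw [Nat.floor_div_natCast, Nat.floor_natCast] at h6
      linarith
    calc _ = ((N : ℝ) / p - 1) * Real.log p := by ring
      _ ≤ _ := mul_le_mul_of_nonneg_right h4 (Real.log_nonneg h1.le)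
  rw [Finset.sum_sub_distrib, ← Finset.mul_sum] at h2
  refine le_of_mul_le_mul_left ?_ hN'
  linarith

theorem inv_le_neg_log_one_sub_inv {x : ℝ} (hx : 1 < x) : x⁻¹ ≤ -Real.log (1 - x⁻¹) := by
  have := Real.log_le_sub_one_of_pos (x := 1 - x⁻¹) (by linarith [inv_lt_one_of_one_lt₀ hx])
  linarith

theorem neg_log_one_sub_inv_le {x : ℝ} (hx : 1 < x) : -Real.log (1 - x⁻¹) ≤ (x - 1)⁻¹ := by
  have h1 := inv_lt_one_of_one_lt₀ hx
  have := Real.one_sub_inv_le_log_of_pos (x := 1 - x⁻¹) (by linarith)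
  have h2 : (1 - x⁻¹)⁻¹ = 1 + (x - 1)⁻¹ := by
    have : x - 1 ≠ 0 := by linarith
    have : x ≠ 0 := by linarith
    field_simp
    ring
  linarith

theorem summable_log_div_mul_sub_one :
    Summable fun n : ℕ => Real.log n / ((n : ℝ) * ((n : ℝ) - 1)) := by
  have hs : Summable fun n : ℕ => 4 * (1 / (n : ℝ) ^ (3 / 2 : ℝ)) :=
    (Real.summable_one_div_nat_rpow.2 (by norm_num)).mul_left 4
  refine Summable.of_norm_bounded_eventually_nat hs ?_
  filter_upwards [eventually_ge_atTop 2] with n hn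
  have hn' : (2 : ℝ) ≤ n := by exact_mod_cast hn
  have h0 : (0 : ℝ) < n := by linarith
  have hl := Real.log_nonneg (x := n) (by linarith)
  rw [Real.norm_of_nonneg (div_nonneg hl (mul_nonneg h0.le (by linarith)))]
  have h1 : Real.log n ≤ (n : ℝ) ^ (1 / 2 : ℝ) / (1 / 2) := Real.log_le_rpow_div h0.le (by norm_num)
  have h2 : (n : ℝ) ^ (1 / 2 : ℝ) * (n : ℝ) ^ (3 / 2 : ℝ) = (n : ℝ) ^ 2 := by
    rw [← Real.rpow_add h0]; norm_num
  have h3 : 0 < (n : ℝ) ^ (3 / 2 : ℝ) := by positivity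
  rw [mul_one_div, div_le_div_iff₀ (mul_pos h0 (by linarith)) h3]
  nlinarith [mul_le_mul_of_nonneg_right h1 h3.le]

/-- Mertens' first theorem, with the weight `-log (1 - 1 / p) * log p` in place of `log p / p`. -/
theorem exists_abs_sum_neg_log_mul_log_sub_log_le :
    ∃ C : ℝ, ∀ N : ℕ, 0 < N →
      |∑ p ∈ Nat.primesLE N, -Real.log (1 - (p : ℝ)⁻¹) * Real.log p - Real.log N| ≤ C := by
  set K := ∑' n : ℕ, Real.log n / ((n : ℝ) * ((n : ℝ) - 1)) with hK
  refine ⟨K + 2, fun N hN => ?_⟩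
  have h1 := log_sub_one_le_sum_log_div_sub_one hN
  have h2 := sum_log_div_le_log_add hN
  have h3 : ∑ p ∈ Nat.primesLE N, Real.log p / ((p : ℝ) * ((p : ℝ) - 1)) ≤ K := by
    refine summable_log_div_mul_sub_one.sum_le_tsum _ fun n _ => ?_
    rcases n.eq_zero_or_pos with rfl | hn
    · simp
    have : (1 : ℝ) ≤ n := by exact_mod_cast hn
    exact div_nonneg (Real.log_nonneg this) (mul_nonneg (by linarith) (by linarith))
  have h4 : ∑ p ∈ Nat.primesLE N, Real.log p / ((p : ℝ) - 1) =
      ∑ p ∈ Nat.primesLE N, Real.log p / (p : ℝ) +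
        ∑ p ∈ Nat.primesLE N, Real.log p / ((p : ℝ) * ((p : ℝ) - 1)) := by
    rw [← Finset.sum_add_distrib]
    refine Finset.sum_congr rfl fun p hp => ?_
    have h1 : (1 : ℝ) < p := by exact_mod_cast (Nat.mem_primesLE.1 hp).2.one_lt
    have : (p : ℝ) - 1 ≠ 0 := by linarith
    field_simp
    ring
  have h5 : ∑ p ∈ Nat.primesLE N, Real.log p / (p : ℝ) ≤
      ∑ p ∈ Nat.primesLE N, -Real.log (1 - (p : ℝ)⁻¹) * Real.log p := by
    refine Finset.sum_le_sum fun p hp => ?_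
    have h1 : (1 : ℝ) < p := by exact_mod_cast (Nat.mem_primesLE.1 hp).2.one_lt
    rw [div_eq_inv_mul]
    exact mul_le_mul_of_nonneg_right (inv_le_neg_log_one_sub_inv h1) (Real.log_nonneg h1.le)
  have h6 : ∑ p ∈ Nat.primesLE N, -Real.log (1 - (p : ℝ)⁻¹) * Real.log p ≤
      ∑ p ∈ Nat.primesLE N, Real.log p / ((p : ℝ) - 1) := by
    refine Finset.sum_le_sum fun p hp => ?_
    have h1 : (1 : ℝ) < p := by exact_mod_cast (Nat.mem_primesLE.1 hp).2.one_lt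
    rw [div_eq_inv_mul]
    exact mul_le_mul_of_nonneg_right (neg_log_one_sub_inv_le h1) (Real.log_nonneg h1.le)
  have h7 : Real.log 4 ≤ 2 := by
    rw [show (4 : ℝ) = 2 ^ 2 by norm_num, Real.log_pow]
    have := Real.log_two_lt_d9
    push_cast
    linarith
  rw [abs_le]
  constructor <;> linarith

/-- If the partial sums of `w ≥ 0` up to `⌊exp m⌋` are within `C` of `m`, then for nonnegative
antitone `f` the sums of `w i * f (log i)` over `⌊exp U⌋ < i ≤ ⌊exp V⌋` and of `f m` over
`U < m ≤ V` differ by `O(f U)`. -/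
theorem abs_sum_mul_comp_log_sub_sum_le {w : ℕ → ℝ} (hw : ∀ i, 0 ≤ w i) {C : ℝ}
    (hC : ∀ m : ℕ, |∑ i ∈ Finset.range (⌊Real.exp m⌋₊ + 1), w i - m| ≤ C)
    {f : ℝ → ℝ} (hf : AntitoneOn f (Set.Ioi 0)) (hf0 : ∀ x, 0 < x → 0 ≤ f x)
    {U V : ℕ} (hU : 1 ≤ U) (hUV : U ≤ V) :
    |(∑ i ∈ Finset.range (⌊Real.exp V⌋₊ + 1), w i * f (Real.log i) -
        ∑ m ∈ Finset.range V, f ((m + 1 : ℕ) : ℝ)) -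
      (∑ i ∈ Finset.range (⌊Real.exp U⌋₊ + 1), w i * f (Real.log i) -
        ∑ m ∈ Finset.range U, f ((m + 1 : ℕ) : ℝ))| ≤ (2 * C + 1) * f U := by
  set B : ℕ → ℝ := fun m => ∑ i ∈ Finset.range (⌊Real.exp m⌋₊ + 1), w i with hB
  set S : ℕ → ℝ := fun m => ∑ i ∈ Finset.range (⌊Real.exp m⌋₊ + 1), w i * f (Real.log i) with hS
  have hE : ∀ m : ℕ, ⌊Real.exp m⌋₊ ≤ ⌊Real.exp (m + 1 : ℕ)⌋₊ := fun m =>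
    Nat.floor_le_floor (Real.exp_le_exp.2 (by push_cast; linarith))
  have hdiff : ∀ (g : ℕ → ℝ) (m : ℕ), ∑ i ∈ Finset.range (⌊Real.exp (m + 1 : ℕ)⌋₊ + 1), g i -
      ∑ i ∈ Finset.range (⌊Real.exp m⌋₊ + 1), g i =
      ∑ i ∈ Finset.Ico (⌊Real.exp m⌋₊ + 1) (⌊Real.exp (m + 1 : ℕ)⌋₊ + 1), g i := fun g m =>
    (Finset.sum_Ico_eq_sub g (Nat.succ_le_succ (hE m))).symm
  have hlog : ∀ m : ℕ, ∀ i ∈ Finset.Ico (⌊Real.exp m⌋₊ + 1) (⌊Real.exp (m + 1 : ℕ)⌋₊ + 1),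
      (m : ℝ) ≤ Real.log i ∧ Real.log i ≤ (m + 1 : ℕ) := by
    intro m i hi
    rw [Finset.mem_Ico] at hi
    have h1 : Real.exp m < i := (Nat.floor_lt (Real.exp_pos _).le).1 hi.1
    have h2 : (i : ℝ) ≤ Real.exp (m + 1 : ℕ) :=
      (Nat.le_floor_iff (Real.exp_pos _).le).1 (Nat.lt_succ_iff.1 hi.2)
    have h0 : (0 : ℝ) < i := (Real.exp_pos _).trans h1
    exact ⟨(Real.le_log_iff_exp_le h0).2 h1.le, (Real.log_le_iff_le_exp h0).2 h2⟩
  have hup : ∀ m : ℕ, 1 ≤ m → S (m + 1) - S m ≤ (B (m + 1) - B m) * f m := by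
    intro m hm
    have hm' : (0 : ℝ) < m := by exact_mod_cast hm
    simp only [hS, hB, hdiff]
    rw [Finset.sum_mul]
    refine Finset.sum_le_sum fun i hi => mul_le_mul_of_nonneg_left ?_ (hw i)
    exact hf hm' (hm'.trans_le (hlog m i hi).1) (hlog m i hi).1
  have hlo : ∀ m : ℕ, 1 ≤ m → (B (m + 1) - B m) * f (m + 1 : ℕ) ≤ S (m + 1) - S m := by
    intro m hm
    have hm' : (0 : ℝ) < m := by exact_mod_cast hm
    simp only [hS, hB, hdiff]
    rw [Finset.sum_mul]
    refine Finset.sum_le_sum fun i hi => mul_le_mul_of_nonneg_left ?_ (hw i)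
    have h0 := hm'.trans_le (hlog m i hi).1
    exact hf h0 (h0.trans_le (hlog m i hi).2) (hlog m i hi).2
  have hmono : ∀ m : ℕ, 1 ≤ m → f (m + 1 : ℕ) ≤ f m := by
    intro m hm
    have hm' : (0 : ℝ) < m := by exact_mod_cast hm
    exact hf hm' (by push_cast; exact add_pos hm' one_pos) (by push_cast; linarith)
  have hR : ∀ m : ℕ, -C ≤ B m - m ∧ B m - m ≤ C := fun m => abs_le.1 (hC m)
  have key : (S V - ∑ m ∈ Finset.range V, f ((m + 1 : ℕ) : ℝ)) -
        (S U - ∑ m ∈ Finset.range U, f ((m + 1 : ℕ) : ℝ)) ≤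
        (B V - V - 1) * f V - (B U - U - 1) * f U + C * (f U - f V) ∧
      (B V - V) * f V - (B U - U) * f U - C * (f U - f V) ≤
        (S V - ∑ m ∈ Finset.range V, f ((m + 1 : ℕ) : ℝ)) -
        (S U - ∑ m ∈ Finset.range U, f ((m + 1 : ℕ) : ℝ)) := by
    induction V, hUV using Nat.le_induction with
    | base => constructor <;> linarith
    | succ V hV ih =>
      have hV1 := hU.trans hV
      have h1 := hup V hV1
      have h2 := hlo V hV1
      have h3 := hmono V hV1
      have h4 := mul_nonneg (sub_nonneg.2 (hR (V + 1)).2) (sub_nonneg.2 h3)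
      have h5 := mul_nonneg (sub_nonneg.2 (hR V).1) (sub_nonneg.2 h3)
      rw [Finset.sum_range_succ]
      push_cast at *
      constructor <;> linarith [ih.1, ih.2]
  have hV0 : 0 ≤ f V := hf0 _ (by exact_mod_cast hU.trans hUV)
  have hU0 : 0 ≤ f U := hf0 _ (by exact_mod_cast hU)
  have h1 := mul_nonneg (sub_nonneg.2 (hR V).2) hV0
  have h2 := mul_nonneg (sub_nonneg.2 (hR V).1) hV0
  have h3 := mul_nonneg (sub_nonneg.2 (hR U).2) hU0
  have h4 := mul_nonneg (sub_nonneg.2 (hR U).1) hU0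
  rw [abs_le]
  constructor <;> linarith [key.1, key.2]

theorem sum_primesLE_eq_sum_range (g : ℕ → ℝ) (N : ℕ) :
    ∑ p ∈ Nat.primesLE N, g p = ∑ i ∈ Finset.range (N + 1), if i.Prime then g i else 0 := by
  rw [← Finset.sum_filter]
  rfl

theorem sub_one_inv_le_two_mul_inv {x : ℝ} (hx : 2 ≤ x) : (x - 1)⁻¹ ≤ 2 * x⁻¹ := by
  rw [← div_eq_mul_inv, inv_eq_one_div, div_le_div_iff₀ (by linarith) (by linarith)]
  linarith

theorem two_le_rpow_of_two_le {x s : ℝ} (hx : 2 ≤ x) (hs : 1 ≤ s) : 2 ≤ x ^ s :=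
  hx.trans (Real.self_le_rpow_of_one_le (by linarith) hs)

theorem summable_neg_log_one_sub_rpow_primes {s : ℝ} (hs : 1 < s) :
    Summable fun i : ℕ => if i.Prime then -Real.log (1 - (i : ℝ) ^ (-s)) else 0 := by
  refine Summable.of_norm_bounded ((Real.summable_nat_rpow_inv.2 hs).mul_left 2) fun i => ?_
  split_ifs with hi
  · have h2 : (2 : ℝ) ≤ i := by exact_mod_cast hi.two_le
    have h3 := two_le_rpow_of_two_le h2 hs.le
    rw [Real.rpow_neg (by linarith)]
    have h4 := inv_le_neg_log_one_sub_inv (x := (i : ℝ) ^ s) (by linarith)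
    have h5 := neg_log_one_sub_inv_le (x := (i : ℝ) ^ s) (by linarith)
    rw [Real.norm_of_nonneg ((inv_nonneg.2 (by linarith)).trans h4)]
    exact h5.trans (sub_one_inv_le_two_mul_inv h3)
  · simp; positivity

theorem summable_neg_log_one_sub_inv_mul_rpow_primes {ε : ℝ} (hε : 0 < ε) :
    Summable fun i : ℕ =>
      if i.Prime then -Real.log (1 - (i : ℝ)⁻¹) * (i : ℝ) ^ (-ε) else 0 := by
  refine Summable.of_norm_bounded
    ((Real.summable_nat_rpow_inv.2 (show 1 < 1 + ε by linarith)).mul_left 2) fun i => ?_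
  split_ifs with hi
  · have h2 : (2 : ℝ) ≤ i := by exact_mod_cast hi.two_le
    have h4 := inv_le_neg_log_one_sub_inv (x := (i : ℝ)) (by linarith)
    have h5 := neg_log_one_sub_inv_le (x := (i : ℝ)) (by linarith)
    have h6 : 0 ≤ (i : ℝ) ^ (-ε) := by positivity
    rw [Real.norm_of_nonneg (mul_nonneg ((inv_nonneg.2 (by linarith)).trans h4) h6),
      Real.rpow_add (by linarith), Real.rpow_one, mul_inv, ← Real.rpow_neg (by linarith),
      ← mul_assoc]
    exact mul_le_mul_of_nonneg_right (h5.trans (sub_one_inv_le_two_mul_inv h2)) h6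
  · simp; positivity

theorem abs_neg_log_mul_rpow_sub_le {x ε : ℝ} (hx : 2 ≤ x) (hε : 0 < ε) :
    |-Real.log (1 - x⁻¹) * x ^ (-ε) - -Real.log (1 - x ^ (-(1 + ε)))| ≤ 2 * (x ^ 2)⁻¹ := by
  have hx0 : 0 < x := by linarith
  have hgap : ∀ y : ℝ, x ≤ y → (y - 1)⁻¹ - y⁻¹ ≤ 2 * (x ^ 2)⁻¹ := by
    intro y hy
    have h1 : (y - 1)⁻¹ - y⁻¹ = (y * (y - 1))⁻¹ := by
      have : y - 1 ≠ 0 := by linarith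
      have : y ≠ 0 := by linarith
      field_simp
      ring
    rw [h1, ← div_eq_mul_inv, inv_eq_one_div,
      div_le_div_iff₀ (mul_pos (by linarith) (by linarith)) (by positivity)]
    nlinarith
  have hxs : x ≤ x ^ (1 + ε) := Real.self_le_rpow_of_one_le (by linarith) (by linarith)
  rw [Real.rpow_neg hx0.le (1 + ε)]
  have a1 := inv_le_neg_log_one_sub_inv (x := x) (by linarith)
  have a2 := neg_log_one_sub_inv_le (x := x) (by linarith)
  have b1 := inv_le_neg_log_one_sub_inv (x := x ^ (1 + ε)) (by linarith)
  have b2 := neg_log_one_sub_inv_le (x := x ^ (1 + ε)) (by linarith)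
  have c0 : 0 ≤ x ^ (-ε) := by positivity
  have c1 : x ^ (-ε) ≤ 1 := Real.rpow_le_one_of_one_le_of_nonpos (by linarith) (by linarith)
  have c2 : (x ^ (1 + ε))⁻¹ = x⁻¹ * x ^ (-ε) := by
    rw [Real.rpow_add hx0, Real.rpow_one, mul_inv, Real.rpow_neg hx0.le]
  have d1 := hgap x le_rfl
  have d2 := hgap _ hxs
  have e1 := mul_le_mul_of_nonneg_right a1 c0
  have e2 := mul_le_mul_of_nonneg_right a2 c0
  have e3 : ((x - 1)⁻¹ - x⁻¹) * x ^ (-ε) ≤ 2 * (x ^ 2)⁻¹ :=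
    (mul_le_of_le_one_right (by linarith) c1).trans d1
  rw [abs_le]
  constructor <;> nlinarith

theorem tendsto_tsum_mul_rpow_sub_tsum_neg_log :
    Tendsto (fun ε : ℝ =>
      (∑' i : ℕ, if i.Prime then -Real.log (1 - (i : ℝ)⁻¹) * (i : ℝ) ^ (-ε) else 0) -
        ∑' i : ℕ, if i.Prime then -Real.log (1 - (i : ℝ) ^ (-(1 + ε))) else 0)
      (𝓝[>] 0) (𝓝 0) := by
  have hb : Summable fun i : ℕ => 2 * ((i : ℝ) ^ 2)⁻¹ :=
    (Real.summable_nat_pow_inv.2 one_lt_two).mul_left 2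
  have key := tendsto_tsum_of_dominated_convergence (𝓕 := 𝓝[>] (0 : ℝ)) (g := fun _ : ℕ => (0 : ℝ))
    (f := fun (ε : ℝ) (i : ℕ) =>
      (if i.Prime then -Real.log (1 - (i : ℝ)⁻¹) * (i : ℝ) ^ (-ε) else 0) -
        if i.Prime then -Real.log (1 - (i : ℝ) ^ (-(1 + ε))) else 0) hb ?_ ?_
  · rw [tsum_zero] at key
    refine key.congr' ?_
    filter_upwards [self_mem_nhdsWithin] with ε hε
    exact (summable_neg_log_one_sub_inv_mul_rpow_primes hε).tsum_sub
      (summable_neg_log_one_sub_rpow_primes (by simpa using hε))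
  · intro i
    by_cases hi : i.Prime
    · simp only [hi, if_true]
      have h0 : (0 : ℝ) < i := by exact_mod_cast hi.pos
      have h1 : (1 : ℝ) < i := by exact_mod_cast hi.one_lt
      have h2 : 1 - (i : ℝ)⁻¹ ≠ 0 := by linarith [inv_lt_one_of_one_lt₀ h1]
      have hc : ContinuousAt (fun ε : ℝ => -Real.log (1 - (i : ℝ)⁻¹) * (i : ℝ) ^ (-ε) -
          -Real.log (1 - (i : ℝ) ^ (-(1 + ε)))) 0 := by
        refine ContinuousAt.sub ?_ (ContinuousAt.neg (ContinuousAt.log ?_ ?_))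
        · exact continuousAt_const.mul
            (ContinuousAt.rpow continuousAt_const continuousAt_id.neg (Or.inl h0.ne'))
        · exact continuousAt_const.sub (ContinuousAt.rpow continuousAt_const
            (continuousAt_const.add continuousAt_id).neg (Or.inl h0.ne'))
        · simpa [Real.rpow_neg_one] using h2
      have := hc.tendsto
      simp only [neg_zero, Real.rpow_zero, mul_one, add_zero, Real.rpow_neg_one, sub_self] at this
      exact this.mono_left nhdsWithin_le_nhds
    · simp [hi]
  · filter_upwards [self_mem_nhdsWithin] with ε hε i
    by_cases hi : i.Prime
    · simp only [hi, if_true]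
      exact abs_neg_log_mul_rpow_sub_le (by exact_mod_cast hi.two_le) hε
    · simp [hi]

theorem tsum_neg_log_eq_log_riemannZeta_re {s : ℝ} (hs : 1 < s) :
    (∑' i : ℕ, if i.Prime then -Real.log (1 - (i : ℝ) ^ (-s)) else 0) =
      Real.log (riemannZeta s).re := by
  have h := riemannZeta_eulerProduct_exp_log (s := (s : ℂ)) (by simpa using hs)
  have h1 : ∀ p : Nat.Primes, -Complex.log (1 - (p : ℂ) ^ (-(s : ℂ))) =
      ((-Real.log (1 - ((p : ℕ) : ℝ) ^ (-s)) : ℝ) : ℂ) := by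
    intro p
    have h2 : (2 : ℝ) ≤ (p : ℕ) := by exact_mod_cast p.2.two_le
    have h3 := two_le_rpow_of_two_le h2 hs.le
    have h4 : (0 : ℝ) ≤ 1 - ((p : ℕ) : ℝ) ^ (-s) := by
      rw [Real.rpow_neg (by linarith)]
      linarith [inv_le_one_of_one_le₀ (a := ((p : ℕ) : ℝ) ^ s) (by linarith)]
    rw [Complex.ofReal_neg, Complex.ofReal_log h4, Complex.ofReal_sub,
      Complex.ofReal_cpow (by linarith)]
    push_cast
    rfl
  rw [tsum_congr h1, ← Complex.ofReal_tsum, ← Complex.ofReal_exp] at h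
  rw [← h, Complex.ofReal_re, Real.log_exp]
  have h5 := tsum_subtype {p : ℕ | p.Prime} fun i : ℕ => -Real.log (1 - (i : ℝ) ^ (-s))
  refine Eq.trans (tsum_congr fun i => ?_) h5.symm
  simp [Set.indicator_apply]

theorem tendsto_tsum_neg_log_add_log :
    Tendsto (fun ε : ℝ =>
      (∑' i : ℕ, if i.Prime then -Real.log (1 - (i : ℝ) ^ (-(1 + ε))) else 0) + Real.log ε)
      (𝓝[>] 0) (𝓝 0) := by
  have h := (isLittleO_one_iff ℝ).1 log_riemannZeta_add_log_sub_isLittleO_ofReal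
  have hs : Tendsto (fun ε : ℝ => 1 + ε) (𝓝[>] 0) (𝓝[>] 1) := by
    refine tendsto_nhdsWithin_iff.2 ⟨?_, ?_⟩
    · have : Tendsto (fun ε : ℝ => 1 + ε) (𝓝 0) (𝓝 (1 + 0)) := tendsto_const_nhds.add tendsto_id
      rw [add_zero] at this
      exact this.mono_left nhdsWithin_le_nhds
    · filter_upwards [self_mem_nhdsWithin] with ε hε
      simpa using hε
  refine (h.comp hs).congr' ?_
  filter_upwards [self_mem_nhdsWithin] with ε hε
  rw [tsum_neg_log_eq_log_riemannZeta_re (by simpa using hε)]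
  simp

theorem tendsto_log_one_sub_exp_neg_sub_log :
    Tendsto (fun ε : ℝ => Real.log (1 - Real.exp (-ε)) - Real.log ε) (𝓝[>] 0) (𝓝 0) := by
  have hd : HasDerivAt (fun ε : ℝ => 1 - Real.exp (-ε)) 1 0 := by
    simpa using ((hasDerivAt_neg (0 : ℝ)).exp).const_sub 1
  have h := (hasDerivAt_iff_tendsto_slope.1 hd).mono_left
    (nhdsWithin_mono 0 fun x (hx : x ∈ Set.Ioi 0) => (ne_of_gt hx : x ≠ 0))
  have h2 := h.log one_ne_zero
  rw [Real.log_one] at h2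
  refine h2.congr' ?_
  filter_upwards [self_mem_nhdsWithin] with ε hε
  have hε' : (0 : ℝ) < ε := hε
  have : Real.exp (-ε) < 1 := by simpa using hε'
  rw [← Real.log_div (by linarith) hε'.ne']
  simp [slope_def_field]

theorem tendsto_tsum_mul_rpow_add_log_one_sub_exp :
    Tendsto (fun ε : ℝ =>
      (∑' i : ℕ, if i.Prime then -Real.log (1 - (i : ℝ)⁻¹) * (i : ℝ) ^ (-ε) else 0) +
        Real.log (1 - Real.exp (-ε))) (𝓝[>] 0) (𝓝 0) := by
  have := (tendsto_tsum_mul_rpow_sub_tsum_neg_log.add tendsto_tsum_neg_log_add_log).add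
    tendsto_log_one_sub_exp_neg_sub_log
  rw [add_zero, add_zero] at this
  exact this.congr fun ε => by ring

theorem antitoneOn_exp_neg_mul_div {ε : ℝ} (hε : 0 ≤ ε) :
    AntitoneOn (fun u : ℝ => Real.exp (-(ε * u)) / u) (Set.Ioi 0) := by
  intro x hx y _ hxy
  have hx' : (0 : ℝ) < x := hx
  have := mul_le_mul_of_nonneg_left hxy hε
  exact div_le_div₀ (Real.exp_pos _).le (Real.exp_le_exp.2 (by linarith)) hx' hxy

theorem abs_log_sub_floor_exp_le (m : ℕ) : |Real.log (⌊Real.exp m⌋₊ : ℕ) - m| ≤ 1 := by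
  have h1 : (1 : ℝ) ≤ Real.exp m := Real.one_le_exp (by positivity)
  have h2 : (1 : ℝ) ≤ (⌊Real.exp m⌋₊ : ℕ) := by exact_mod_cast Nat.one_le_floor_iff _ |>.2 h1
  have h3 := Nat.floor_le (Real.exp_pos m).le
  have h4 := Nat.lt_floor_add_one (Real.exp m)
  have h5 : Real.log (⌊Real.exp m⌋₊ : ℕ) ≤ m :=
    (Real.log_le_iff_le_exp (by linarith)).2 h3
  have h6 : (m : ℝ) - 1 ≤ Real.log (⌊Real.exp m⌋₊ : ℕ) := by
    rw [Real.le_log_iff_exp_le (by linarith), Real.exp_sub, div_le_iff₀ (Real.exp_pos _)]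
    have := Real.add_one_le_exp (1 : ℝ)
    nlinarith
  rw [abs_le]
  constructor <;> linarith

theorem exists_abs_sum_range_floor_exp_sub_le :
    ∃ C : ℝ, ∀ m : ℕ, |∑ i ∈ Finset.range (⌊Real.exp m⌋₊ + 1),
      (if i.Prime then -Real.log (1 - (i : ℝ)⁻¹) * Real.log i else 0) - m| ≤ C := by
  obtain ⟨C, hC⟩ := exists_abs_sum_neg_log_mul_log_sub_log_le
  refine ⟨C + 1, fun m => ?_⟩
  have h1 : (1 : ℝ) ≤ Real.exp m := Real.one_le_exp (by positivity)
  have h2 := hC _ ((Nat.one_le_floor_iff _).2 h1)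
  rw [sum_primesLE_eq_sum_range fun i => -Real.log (1 - (i : ℝ)⁻¹) * Real.log i] at h2
  exact (abs_sub_le _ _ _).trans (add_le_add h2 (abs_log_sub_floor_exp_le m))

theorem neg_log_one_sub_inv_prime_nonneg {i : ℕ} (hi : i.Prime) :
    0 ≤ -Real.log (1 - (i : ℝ)⁻¹) :=
  (inv_nonneg.2 (Nat.cast_nonneg i)).trans
    (inv_le_neg_log_one_sub_inv (by exact_mod_cast hi.one_lt))

/-- The sums of `-log (1 - 1 / p) * p ^ (-ε)` over `p ≤ exp U` and of `exp (-ε m) / m` over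
`1 ≤ m ≤ U` differ by their difference over all `p` and `m`, up to `O(1 / U)` uniformly in `ε`. -/
theorem exists_abs_tsum_sub_partial_sum_le :
    ∃ K : ℝ, ∀ U : ℕ, 1 ≤ U → ∀ ε : ℝ, 0 < ε →
      |((∑' i : ℕ, if i.Prime then -Real.log (1 - (i : ℝ)⁻¹) * (i : ℝ) ^ (-ε) else 0) +
          Real.log (1 - Real.exp (-ε))) -
        (∑ i ∈ Finset.range (⌊Real.exp U⌋₊ + 1),
            (if i.Prime then -Real.log (1 - (i : ℝ)⁻¹) * (i : ℝ) ^ (-ε) else 0) -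
          ∑ m ∈ Finset.range U, Real.exp (-ε) ^ (m + 1) / ((m : ℝ) + 1))| ≤ K / U := by
  obtain ⟨C, hC⟩ := exists_abs_sum_range_floor_exp_sub_le
  have hC0 : 0 ≤ C := (abs_nonneg _).trans (hC 0)
  refine ⟨2 * C + 1, fun U hU ε hε => ?_⟩
  have hU' : (0 : ℝ) < U := by exact_mod_cast hU
  have hw : ∀ i : ℕ, (0 : ℝ) ≤
      if i.Prime then -Real.log (1 - (i : ℝ)⁻¹) * Real.log i else 0 := by
    intro i
    split_ifs with hi
    · exact mul_nonneg (neg_log_one_sub_inv_prime_nonneg hi) (Real.log_natCast_nonneg i)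
    · exact le_rfl
  have hwf : ∀ i : ℕ, (if i.Prime then -Real.log (1 - (i : ℝ)⁻¹) * Real.log i else 0) *
      (Real.exp (-(ε * Real.log i)) / Real.log i) =
      if i.Prime then -Real.log (1 - (i : ℝ)⁻¹) * (i : ℝ) ^ (-ε) else 0 := by
    intro i
    split_ifs with hi
    · have h1 : (1 : ℝ) < i := by exact_mod_cast hi.one_lt
      have h2 := (Real.log_pos h1).ne'
      rw [Real.rpow_def_of_pos (by linarith), show Real.log i * -ε = -(ε * Real.log i) by ring]
      field_simp
    · simp
  have hfm : ∀ m : ℕ, Real.exp (-(ε * ((m + 1 : ℕ) : ℝ))) / ((m + 1 : ℕ) : ℝ) =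
      Real.exp (-ε) ^ (m + 1) / ((m : ℝ) + 1) := by
    intro m
    rw [← Real.exp_nat_mul]
    push_cast
    congr 2
    ring
  have hstep : ∀ V : ℕ, U ≤ V → _ := fun V hV =>
    abs_sum_mul_comp_log_sub_sum_le hw hC (antitoneOn_exp_neg_mul_div hε.le)
      (fun x hx => div_nonneg (Real.exp_pos _).le hx.le) hU hV
  simp only [hwf, hfm] at hstep
  have hE : Tendsto (fun V : ℕ => ⌊Real.exp V⌋₊ + 1) atTop atTop :=
    tendsto_atTop_mono (fun V => Nat.le_succ _)
      (tendsto_nat_floor_atTop.comp (Real.tendsto_exp_atTop.comp tendsto_natCast_atTop_atTop))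
  have h1 := (summable_neg_log_one_sub_inv_mul_rpow_primes hε).hasSum.tendsto_sum_nat.comp hE
  have h2 := (Real.hasSum_pow_div_log_of_abs_lt_one (x := Real.exp (-ε)) (by
    rw [abs_of_pos (Real.exp_pos _)]; simpa using hε)).tendsto_sum_nat
  have h3 := h1.sub h2
  rw [sub_neg_eq_add] at h3
  refine (le_of_tendsto (h3.sub_const _).abs (eventually_atTop.2 ⟨U, fun V hV => hstep V hV⟩)).trans
    ?_
  have h4 : Real.exp (-(ε * U)) ≤ 1 := Real.exp_le_one_iff.2 (neg_nonpos.2 (mul_pos hε hU').le)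
  rw [← mul_div_assoc]
  exact div_le_div_of_nonneg_right (mul_le_of_le_one_right (by linarith) h4) hU'.le

theorem exists_abs_sum_neg_log_sub_harmonic_le :
    ∃ K : ℝ, ∀ U : ℕ, 1 ≤ U →
      |∑ p ∈ Nat.primesLE ⌊Real.exp U⌋₊, -Real.log (1 - (p : ℝ)⁻¹) - (harmonic U : ℝ)| ≤ K / U := by
  obtain ⟨K, hK⟩ := exists_abs_tsum_sub_partial_sum_le
  refine ⟨K, fun U hU => ?_⟩
  have hc : ContinuousAt (fun ε : ℝ => ∑ i ∈ Finset.range (⌊Real.exp U⌋₊ + 1),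
            (if i.Prime then -Real.log (1 - (i : ℝ)⁻¹) * (i : ℝ) ^ (-ε) else 0) -
          ∑ m ∈ Finset.range U, Real.exp (-ε) ^ (m + 1) / ((m : ℝ) + 1)) 0 := by
    refine ContinuousAt.sub (tendsto_finsetSum _ fun i _ => ?_) (by fun_prop)
    by_cases hi : i.Prime
    · simp only [hi, if_true]
      exact tendsto_const_nhds.mul (ContinuousAt.rpow continuousAt_const continuousAt_id.neg
        (Or.inl (by exact_mod_cast hi.ne_zero)))
    · simp [hi]
  have h := tendsto_tsum_mul_rpow_add_log_one_sub_exp.sub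
    (hc.tendsto.mono_left (nhdsWithin_le_nhds (s := Set.Ioi 0)))
  have h2 := le_of_tendsto h.abs (by
    filter_upwards [self_mem_nhdsWithin] with ε hε
    exact hK U hU ε hε)
  rw [zero_sub, abs_neg] at h2
  rw [sum_primesLE_eq_sum_range fun i => -Real.log (1 - (i : ℝ)⁻¹)]
  simpa [harmonic, one_div] using h2

theorem prod_primesLE_eq_exp_neg_sum (N : ℕ) :
    ∏ p ∈ Nat.primesLE N, (1 - 1 / (p : ℝ)) =
      Real.exp (-∑ p ∈ Nat.primesLE N, -Real.log (1 - (p : ℝ)⁻¹)) := by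
  rw [Finset.sum_neg_distrib, neg_neg, Real.exp_sum]
  refine Finset.prod_congr rfl fun p hp => ?_
  have h1 : (1 : ℝ) < p := by exact_mod_cast (Nat.mem_primesLE.1 hp).2.one_lt
  rw [Real.exp_log (by linarith [inv_lt_one_of_one_lt₀ h1]), one_div]

theorem antitone_prod_primesLE :
    Antitone fun N : ℕ => ∏ p ∈ Nat.primesLE N, (1 - 1 / (p : ℝ)) := by
  intro M N hMN
  simp only [prod_primesLE_eq_exp_neg_sum]
  refine Real.exp_le_exp.2 (neg_le_neg (Finset.sum_le_sum_of_subset_of_nonneg (fun p hp => ?_)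
    fun p hp _ => neg_log_one_sub_inv_prime_nonneg (Nat.mem_primesLE.1 hp).2))
  rw [Nat.mem_primesLE] at hp ⊢
  exact ⟨hp.1.trans hMN, hp.2⟩

theorem tendsto_prod_primesLE_floor_exp_mul :
    Tendsto (fun U : ℕ => (∏ p ∈ Nat.primesLE ⌊Real.exp U⌋₊, (1 - 1 / (p : ℝ))) * U) atTop
      (𝓝 (Real.exp (-Real.eulerMascheroniConstant))) := by
  obtain ⟨K, hK⟩ := exists_abs_sum_neg_log_sub_harmonic_le
  have h1 : Tendsto (fun U : ℕ => ∑ p ∈ Nat.primesLE ⌊Real.exp U⌋₊, -Real.log (1 - (p : ℝ)⁻¹) -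
      (harmonic U : ℝ)) atTop (𝓝 0) :=
    squeeze_zero_norm' (eventually_atTop.2 ⟨1, fun U hU => hK U hU⟩)
      (tendsto_const_div_atTop_nhds_zero_nat K)
  have h2 := h1.add Real.tendsto_harmonic_sub_log
  rw [zero_add] at h2
  refine ((Real.continuous_exp.tendsto _).comp h2.neg).congr' ?_
  filter_upwards [eventually_ge_atTop 1] with U hU
  have hU' : (0 : ℝ) < U := by exact_mod_cast hU
  rw [prod_primesLE_eq_exp_neg_sum]
  conv_rhs => rw [← Real.exp_log hU', ← Real.exp_add]
  simp only [Function.comp]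
  congr 1
  rw [Real.exp_log hU']
  ring

/-- **Mertens' third theorem**. -/
theorem tendsto_prod_primesLE_mul_log :
    Tendsto (fun k : ℕ => (∏ p ∈ Nat.primesLE k, (1 - 1 / (p : ℝ))) * Real.log k) atTop
      (𝓝 (Real.exp (-Real.eulerMascheroniConstant))) := by
  set P : ℕ → ℝ := fun N => ∏ p ∈ Nat.primesLE N, (1 - 1 / (p : ℝ)) with hP
  have hP0 : ∀ N, 0 ≤ P N := fun N => by
    simp only [hP, prod_primesLE_eq_exp_neg_sum]
    positivity
  have hfl : Tendsto (fun k : ℕ => ⌊Real.log k⌋₊) atTop atTop :=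
    tendsto_nat_floor_atTop.comp (Real.tendsto_log_atTop.comp tendsto_natCast_atTop_atTop)
  have hfl' : Tendsto (fun k : ℕ => ⌊Real.log k⌋₊ + 1) atTop atTop :=
    tendsto_atTop_mono (fun k => Nat.le_succ _) hfl
  have hT : Tendsto (fun U : ℕ => P ⌊Real.exp U⌋₊ * U) atTop
    (𝓝 (Real.exp (-Real.eulerMascheroniConstant))) := tendsto_prod_primesLE_floor_exp_mul
  have hzero : Tendsto (fun U : ℕ => P ⌊Real.exp U⌋₊) atTop (𝓝 0) := by
    have := hT.mul tendsto_inv_atTop_nhds_zero_nat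
    rw [mul_zero] at this
    refine this.congr' ?_
    filter_upwards [eventually_ge_atTop 1] with U hU
    have hU' : (U : ℝ) ≠ 0 := by exact_mod_cast (Nat.one_le_iff_ne_zero.1 hU)
    field_simp
  have hlower : Tendsto (fun k : ℕ => P ⌊Real.exp (⌊Real.log k⌋₊ + 1 : ℕ)⌋₊ * ⌊Real.log k⌋₊) atTop
      (𝓝 (Real.exp (-Real.eulerMascheroniConstant))) := by
    have := (hT.sub hzero).comp hfl'
    rw [sub_zero] at this
    refine this.congr fun k => ?_
    simp only [Function.comp]
    push_cast
    ring
  have hupper : Tendsto (fun k : ℕ => P ⌊Real.exp ⌊Real.log k⌋₊⌋₊ * (⌊Real.log k⌋₊ + 1)) atTop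
      (𝓝 (Real.exp (-Real.eulerMascheroniConstant))) := by
    have := (hT.add hzero).comp hfl
    rw [add_zero] at this
    refine this.congr fun k => ?_
    simp only [Function.comp]
    ring
  refine tendsto_of_tendsto_of_tendsto_of_le_of_le' hlower hupper ?_ ?_
  · filter_upwards [eventually_ge_atTop 1] with k hk
    have hk' : (0 : ℝ) < k := by exact_mod_cast hk
    have h1 : k ≤ ⌊Real.exp (⌊Real.log k⌋₊ + 1 : ℕ)⌋₊ := by
      refine Nat.le_floor ?_
      rw [← Real.log_le_iff_le_exp hk']
      push_cast
      exact (Nat.lt_floor_add_one _).le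
    exact mul_le_mul (antitone_prod_primesLE h1) (Nat.floor_le (Real.log_natCast_nonneg k))
      (Nat.cast_nonneg _) (hP0 k)
  · filter_upwards [eventually_ge_atTop 1] with k hk
    have hk' : (0 : ℝ) < k := by exact_mod_cast hk
    have h1 : ⌊Real.exp ⌊Real.log k⌋₊⌋₊ ≤ k := by
      refine Nat.floor_le_of_le ?_
      rw [← Real.le_log_iff_exp_le hk']
      exact Nat.floor_le (Real.log_natCast_nonneg k)
    exact mul_le_mul (antitone_prod_primesLE h1) (Nat.lt_floor_add_one _).le
      (Real.log_natCast_nonneg k) (hP0 _)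

theorem mainTheorem4 :
    (∀ k : ℕ, 1 ≤ k →
      IsMultiplicativeSidon k (coprimeSet k) ∧
      HasNatDensity (coprimeSet k) (∏ p ∈ Nat.primesLE k, (1 - 1 / (p : ℝ)))) ∧
    (fun k : ℕ => ∏ p ∈ Nat.primesLE k, (1 - 1 / (p : ℝ))) ~[atTop]
      (fun k : ℕ => Real.exp (-Real.eulerMascheroniConstant) / Real.log (k : ℝ)) := by
  refine ⟨fun k _ => ⟨isMultiplicativeSidon_coprimeSet k, hasNatDensity_coprimeSet k⟩, ?_⟩
  have hlog : ∀ᶠ k : ℕ in atTop, Real.log k ≠ 0 := by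
    filter_upwards [eventually_ge_atTop 2] with k hk
    exact (Real.log_pos (by exact_mod_cast hk)).ne'
  rw [isEquivalent_iff_tendsto_one (by
    filter_upwards [hlog] with k hk
    exact div_ne_zero (Real.exp_pos _).ne' hk)]
  have h := tendsto_prod_primesLE_mul_log.div_const (Real.exp (-Real.eulerMascheroniConstant))
  rw [div_self (Real.exp_pos _).ne'] at h
  refine h.congr fun k => ?_
  simp only [Pi.div_apply, div_div_eq_mul_div]
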